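/- Let $1\le m\le n$ and let $\mu=2^m1^{n-m}$, the partition of $n+m$ whose Young diagram has two columns, of lengths $n$ and $m$. All vector spaces are over $\mathbb{C}$. A tableau is a filling $t$ of the diagram of $\mu$ in which each of $1,\dots,n+m$ appears exactly once; $C_t\le S_{n+m}$ is its column stabilizer, and $\{t\}$ is its row tabloid, i.e. the class of all tableaux with the same entries as $t$ in each row. The Specht module $S^\mu$ is the span of the polytabloids $\varepsilon_t=\sum_{\beta\in C_t}\operatorname{sgn}(\beta)\{\beta t\}$ in the vector space with basis the row tabloids of shape $\mu$. Let $\tilde M^\mu$ be the vector space generated by symbols $[t]$, one for each tableau $t$ of shape $\mu$, modulo the relations $[t]=\operatorname{sgn}(\beta)[\beta t]$ for $\beta\in C_t$. The group $S_{n+m}$ acts on $S^\mu$ and on $\tilde M^\mu$ by permuting entries: $\sigma\{t\}=\{\sigma t\}$ and $\sigma[t]=[\sigma t]$. Let $\alpha:\tilde M^\mu\to S^\mu$ be the equivariant linear map $[t]\mapsto\varepsilon_t$, and let $\eta:\tilde M^\mu\to\tilde M^\mu$ be the equivariant linear map $$\eta([t])=\sum_{j=1}^m\Bigl([t]-\sum_{i=1}^n[t_{i,j}]\Bigr),$$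 where $t_{i,j}$ is obtained from $t$ by exchanging the $i$-th entry of the first column with the $j$-th entry of the second column. Then $\ker(\eta)\cong S^\mu$ as representations of $S_{n+m}$, and $\operatorname{im}(\eta)=\ker(\alpha)$. -/

import Mathlib

noncomputable section

namespace TwoColumn

open Equiv

/-- The two-column Young diagram `2^m 1^(n-m)` (for `m ≤ n`): its first column consists of the cells
`(0, 0), …, (n - 1, 0)` and its second column of the cells `(0, 1), …, (m - 1, 1)`.
(Cells are pairs (row, column), counted from `0`.) -/
def shape (n m : ℕ) (h : m ≤ n) : YoungDiagram where
  cells := (Finset.range n ×ˢ {0}) ∪ (Finset.range m ×ˢ {1})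
  isLowerSet := by
    rintro ⟨a, b⟩ ⟨c, d⟩ ⟨h1, h2⟩ hab
    simp at h1 h2 hab ⊢
    omega

/-- A Young tableau of shape `μ` in which each of the `N` letters appears exactly once.
(There are none unless `N` is the number of cells of `μ`.) -/
def Tableau (μ : YoungDiagram) (N : ℕ) : Type := μ.cells ≃ Fin N

variable {μ : YoungDiagram} {N : ℕ}

theorem sign_conj (σ β : Perm (Fin N)) : Perm.sign (σ * β * σ⁻¹) = Perm.sign β := by
  rw [map_mul, map_mul, mul_right_comm, map_inv, mul_inv_cancel, one_mul]

namespace Tableau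

/-- The entry of `t` in the cell `c`. -/
def entry (t : Tableau μ N) (c : μ.cells) : Fin N := Equiv.toFun t c

/-- The cell of `t` that contains the letter `a`. -/
def cell (t : Tableau μ N) (a : Fin N) : μ.cells := Equiv.invFun t a

/-- The index of the row of `t` that contains the letter `a`. -/
def rowOf (t : Tableau μ N) (a : Fin N) : ℕ := (t.cell a).1.1

/-- The index of the column of `t` that contains the letter `a`. -/
def colOf (t : Tableau μ N) (a : Fin N) : ℕ := (t.cell a).1.2

/-- Permutations act on tableaux by permuting the entries. -/
instance : MulAction (Perm (Fin N)) (Tableau μ N) where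
  smul σ t := Equiv.trans t σ
  one_smul _ := rfl
  mul_smul _ _ _ := rfl

@[simp] theorem entry_smul (σ : Perm (Fin N)) (t : Tableau μ N) (c : μ.cells) :
    (σ • t).entry c = σ (t.entry c) := rfl

@[simp] theorem cell_smul (σ : Perm (Fin N)) (t : Tableau μ N) (a : Fin N) :
    (σ • t).cell a = t.cell (σ⁻¹ a) := rfl

@[simp] theorem rowOf_smul (σ : Perm (Fin N)) (t : Tableau μ N) (a : Fin N) :
    (σ • t).rowOf a = t.rowOf (σ⁻¹ a) := rfl

@[simp] theorem colOf_smul (σ : Perm (Fin N)) (t : Tableau μ N) (a : Fin N) :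
    (σ • t).colOf a = t.colOf (σ⁻¹ a) := rfl

@[simp] theorem cell_entry (t : Tableau μ N) (c : μ.cells) : t.cell (t.entry c) = c :=
  Equiv.left_inv t c

@[simp] theorem entry_cell (t : Tableau μ N) (a : Fin N) : t.entry (t.cell a) = a :=
  Equiv.right_inv t a

/-- The column stabilizer `C_t`: the permutations that map the set of entries of each column of `t`
to itself. -/
def colStabilizer (t : Tableau μ N) : Subgroup (Perm (Fin N)) where
  carrier := {β | ∀ a, t.colOf (β a) = t.colOf a}
  one_mem' _ := rfl
  mul_mem' {β γ} hβ hγ a := (hβ (γ a)).trans (hγ a)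
  inv_mem' {β} hβ a := by simpa using (hβ (β⁻¹ a)).symm

theorem mem_colStabilizer {t : Tableau μ N} {β : Perm (Fin N)} :
    β ∈ t.colStabilizer ↔ ∀ a, t.colOf (β a) = t.colOf a := Iff.rfl

instance (t : Tableau μ N) : DecidablePred (· ∈ t.colStabilizer) := fun β =>
  inferInstanceAs (Decidable (∀ a, t.colOf (β a) = t.colOf a))

theorem mem_colStabilizer_smul {t : Tableau μ N} {σ β : Perm (Fin N)} :
    β ∈ (σ • t).colStabilizer ↔ σ⁻¹ * β * σ ∈ t.colStabilizer := by
  simp only [mem_colStabilizer, colOf_smul, Perm.mul_apply]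
  refine ⟨fun h a => by simpa using h (σ a), fun h a => by simpa using h (σ⁻¹ a)⟩

/-- Two tableaux are row equivalent if they have the same entries in each row. -/
def rowSetoid (μ : YoungDiagram) (N : ℕ) : Setoid (Tableau μ N) where
  r s t := ∀ a, s.rowOf a = t.rowOf a
  iseqv := ⟨fun _ _ => rfl, fun h a => (h a).symm, fun h k a => (h a).trans (k a)⟩

end Tableau

/-- The complex permutation representation on the vector space with basis a `G`-set `X`. -/
def permRep (G X : Type) [Group G] [MulAction G X] : Representation ℂ G (X →₀ ℂ) where
  toFun g := Finsupp.lmapDomain ℂ ℂ (g • ·)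
  map_one' := by ext; simp
  map_mul' g h := by ext; simp [mul_smul]

@[simp] theorem permRep_single {G X : Type} [Group G] [MulAction G X] (g : G) (x : X) (z : ℂ) :
    permRep G X g (Finsupp.single x z) = Finsupp.single (g • x) z := by
  simp [permRep]

/-! ### Row tabloids, polytabloids and the Specht module -/

/-- Row tabloids: classes of tableaux with the same entries in each row. -/
def RowTabloid (μ : YoungDiagram) (N : ℕ) : Type := Quotient (Tableau.rowSetoid μ N)

/-- The row tabloid `{t}`. -/
def rowTabloid (t : Tableau μ N) : RowTabloid μ N := Quotient.mk _ t

/-- The action `σ {t} = {σ t}`. -/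
instance : MulAction (Perm (Fin N)) (RowTabloid μ N) where
  smul σ := Quotient.map (σ • ·) fun _ _ h a => h (σ⁻¹ a)
  one_smul x := Quotient.inductionOn x fun _ => rfl
  mul_smul _ _ x := Quotient.inductionOn x fun _ => rfl

@[simp] theorem smul_rowTabloid (σ : Perm (Fin N)) (t : Tableau μ N) :
    σ • rowTabloid t = rowTabloid (σ • t) := rfl

/-- The polytabloid `ε_t = ∑_{β ∈ C_t} sgn(β) {β t}`. -/
def polytabloid (t : Tableau μ N) : RowTabloid μ N →₀ ℂ :=
  ∑ β : t.colStabilizer,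
    ((Perm.sign β.1 : ℤ) : ℂ) • Finsupp.single (rowTabloid (β.1 • t)) (1 : ℂ)

theorem permRep_polytabloid (σ : Perm (Fin N)) (t : Tableau μ N) :
    permRep (Perm (Fin N)) (RowTabloid μ N) σ (polytabloid t) = polytabloid (σ • t) := by
  simp only [polytabloid, map_sum, map_smul, permRep_single, smul_rowTabloid]
  refine Finset.sum_bij' (fun β _ => ⟨σ * β.1 * σ⁻¹, ?_⟩) (fun β _ => ⟨σ⁻¹ * β.1 * σ, ?_⟩)
    ?_ ?_ ?_ ?_ ?_
  · rw [Tableau.mem_colStabilizer_smul]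
    simp [mul_assoc]
  · exact Tableau.mem_colStabilizer_smul.1 β.2
  · simp
  · simp
  · intro β _; ext1; simp [mul_assoc]
  · intro β _; ext1; simp [mul_assoc]
  · intro β _
    simp only [sign_conj, smul_smul, inv_mul_cancel_right]

theorem polytabloid_smul_of_mem (t : Tableau μ N) {β : Perm (Fin N)} (hβ : β ∈ t.colStabilizer) :
    polytabloid (β • t) = ((Perm.sign β : ℤ) : ℂ) • polytabloid t := by
  simp only [polytabloid, Finset.smul_sum]
  refine Finset.sum_bij' (fun γ _ => ⟨γ.1 * β, ?_⟩) (fun γ _ => ⟨γ.1 * β⁻¹, ?_⟩)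
    ?_ ?_ ?_ ?_ ?_
  · have h := Tableau.mem_colStabilizer_smul.1 γ.2
    simpa [mul_assoc] using mul_mem hβ h
  · rw [Tableau.mem_colStabilizer_smul]
    simpa [mul_assoc] using mul_mem (inv_mem hβ) γ.2
  · simp
  · simp
  · intro γ _; ext1; simp [mul_assoc]
  · intro γ _; ext1; simp [mul_assoc]
  · intro γ _
    rcases Int.units_eq_one_or (Perm.sign β) with h | h <;> simp [smul_smul, h]

/-- The Specht module `S^μ`, as a subrepresentation of the space of row tabloids:
the span of all polytabloids. -/
def specht (μ : YoungDiagram) (N : ℕ) :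
    Subrepresentation (permRep (Perm (Fin N)) (RowTabloid μ N)) where
  toSubmodule := Submodule.span ℂ (Set.range polytabloid)
  apply_mem_toSubmodule σ := by
    change Submodule.span ℂ (Set.range polytabloid) ≤
      (Submodule.span ℂ (Set.range polytabloid)).comap (permRep _ _ σ)
    rw [Submodule.span_le]
    rintro _ ⟨t, rfl⟩
    exact Submodule.subset_span ⟨σ • t, (permRep_polytabloid σ t).symm⟩

/-! ### Column tabloids -/

/-- The span of the antisymmetry relations `[t] - sgn(β) [β t]`, `β ∈ C_t`. -/
def antisymm (μ : YoungDiagram) (N : ℕ) : Submodule ℂ (Tableau μ N →₀ ℂ) :=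
  Submodule.span ℂ {x | ∃ t : Tableau μ N, ∃ β ∈ t.colStabilizer,
    x = Finsupp.single t 1 - ((Perm.sign β : ℤ) : ℂ) • Finsupp.single (β • t) 1}

theorem antisymm_le_comap (μ : YoungDiagram) (N : ℕ) (σ : Perm (Fin N)) :
    antisymm μ N ≤ (antisymm μ N).comap (permRep (Perm (Fin N)) (Tableau μ N) σ) := by
  conv_lhs => rw [antisymm]
  rw [Submodule.span_le]
  rintro _ ⟨t, β, hβ, rfl⟩
  refine Submodule.subset_span ⟨σ • t, σ * β * σ⁻¹, ?_, ?_⟩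
  · rw [Tableau.mem_colStabilizer_smul]
    simpa [mul_assoc] using hβ
  · simp only [map_sub, map_smul, permRep_single, sign_conj, smul_smul, inv_mul_cancel_right]

/-- The space `M̃^μ` of column tabloids. -/
abbrev ColSpace (μ : YoungDiagram) (N : ℕ) : Type := (Tableau μ N →₀ ℂ) ⧸ antisymm μ N

/-- The representation of the symmetric group on `M̃^μ`, with `σ [t] = [σ t]`. -/
def colRep (μ : YoungDiagram) (N : ℕ) : Representation ℂ (Perm (Fin N)) (ColSpace μ N) :=
  (permRep (Perm (Fin N)) (Tableau μ N)).quotient (antisymm μ N) (antisymm_le_comap μ N)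

/-- The column tabloid `[t]`. -/
def colTabloid (t : Tableau μ N) : ColSpace μ N := (antisymm μ N).mkQ (Finsupp.single t 1)

@[simp] theorem colRep_colTabloid (σ : Perm (Fin N)) (t : Tableau μ N) :
    colRep μ N σ (colTabloid t) = colTabloid (σ • t) := by
  simp [colRep, colTabloid]

theorem colTabloid_smul_of_mem (t : Tableau μ N) {β : Perm (Fin N)} (hβ : β ∈ t.colStabilizer) :
    colTabloid (β • t) = ((Perm.sign β : ℤ) : ℂ) • colTabloid t := by
  have h : colTabloid t = ((Perm.sign β : ℤ) : ℂ) • colTabloid (β • t) := by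
    rw [← sub_eq_zero, colTabloid, colTabloid, ← map_smul, ← map_sub, Submodule.mkQ_apply,
      Submodule.Quotient.mk_eq_zero]
    exact Submodule.subset_span ⟨t, β, hβ, rfl⟩
  rw [h, smul_smul]
  rcases Int.units_eq_one_or (Perm.sign β) with h | h <;> simp [h]

theorem colSpace_hom_ext {V : Type*} [AddCommGroup V] [Module ℂ V] {f g : ColSpace μ N →ₗ[ℂ] V}
    (h : ∀ t, f (colTabloid t) = g (colTabloid t)) : f = g := by
  apply Submodule.linearMap_qext
  ext t
  exact h t

/-- A function on tableaux that is antisymmetric within columns extends to a linear map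
on `M̃^μ`, `[t] ↦ f t`. -/
def colLift {V : Type*} [AddCommGroup V] [Module ℂ V] (f : Tableau μ N → V)
    (hf : ∀ t, ∀ β ∈ t.colStabilizer, f (β • t) = ((Perm.sign β : ℤ) : ℂ) • f t) :
    ColSpace μ N →ₗ[ℂ] V :=
  (antisymm μ N).liftQ (Finsupp.linearCombination ℂ f) <| by
    rw [antisymm, Submodule.span_le]
    rintro _ ⟨t, β, hβ, rfl⟩
    have := hf t β hβ
    rcases Int.units_eq_one_or (Perm.sign β) with h | h <;>
      simp_all [Finsupp.linearCombination_single]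

@[simp] theorem colLift_colTabloid {V : Type*} [AddCommGroup V] [Module ℂ V]
    (f : Tableau μ N → V) (hf) (t : Tableau μ N) : colLift f hf (colTabloid t) = f t := by
  simp [colLift, colTabloid]

/-! ### The map `α` -/

/-- The map `α : M̃^μ → S^μ`, `[t] ↦ ε_t`. -/
def alpha (μ : YoungDiagram) (N : ℕ) :
    (colRep μ N).IntertwiningMap (specht μ N).toRepresentation where
  toLinearMap := colLift (V := (specht μ N).toSubmodule)
    (fun t => ⟨polytabloid t, Submodule.subset_span ⟨t, rfl⟩⟩)
    fun t β hβ => Subtype.ext (polytabloid_smul_of_mem t hβ)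
  isIntertwining' σ := by
    refine colSpace_hom_ext (V := (specht μ N).toSubmodule) fun t => ?_
    rw [LinearMap.comp_apply, LinearMap.comp_apply, colRep_colTabloid, colLift_colTabloid,
      colLift_colTabloid]
    exact Subtype.ext (permRep_polytabloid σ t).symm

theorem alpha_colTabloid (t : Tableau μ N) :
    ((alpha μ N (colTabloid t) : (specht μ N).toSubmodule) : RowTabloid μ N →₀ ℂ) =
      polytabloid t := by
  have h : alpha μ N (colTabloid t) =
      (⟨polytabloid t, Submodule.subset_span ⟨t, rfl⟩⟩ : (specht μ N).toSubmodule) :=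
    colLift_colTabloid (V := (specht μ N).toSubmodule)
      (fun t => ⟨polytabloid t, Submodule.subset_span ⟨t, rfl⟩⟩)
      (fun t _ hβ => Subtype.ext (polytabloid_smul_of_mem t hβ)) t
  rw [h]

/-! ### The map `η` -/

/-- The cells of the column with index `j`. -/
def colCells (μ : YoungDiagram) (j : ℕ) : Finset μ.cells := Finset.univ.filter fun c => c.1.2 = j

/-- The tableau obtained from `t` by exchanging the entries in the cells `c` and `d`. -/
def exchange (t : Tableau μ N) (c d : μ.cells) : Tableau μ N := swap (t.entry c) (t.entry d) • t

/-- For a cell `d` of the second column: the sum of the column tabloids obtained from `t` by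
exchanging the entry in `d` with each of the entries of the first column. -/
def piOne (t : Tableau μ N) (d : μ.cells) : ColSpace μ N :=
  ∑ c ∈ colCells μ 0, colTabloid (exchange t c d)

/-- The dual Garnir relation `[t] - π(t)` that belongs to a cell `d` of the second column. -/
def garnirOne (t : Tableau μ N) (d : μ.cells) : ColSpace μ N := colTabloid t - piOne t d

/-- The sum of these dual Garnir relations over the cells of the second column. -/
def etaFun (t : Tableau μ N) : ColSpace μ N := ∑ d ∈ colCells μ 1, garnirOne t d

theorem exchange_smul (σ : Perm (Fin N)) (t : Tableau μ N) (c d : μ.cells) :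
    exchange (σ • t) c d = σ • exchange t c d := by
  simp only [exchange, Tableau.entry_smul, smul_smul]
  rw [swap_apply_apply, inv_mul_cancel_right]

theorem sum_colCells_reindex {V : Type*} [AddCommGroup V] (t : Tableau μ N) {β : Perm (Fin N)}
    (hβ : β ∈ t.colStabilizer) (j : ℕ) (F : μ.cells → V) :
    ∑ c ∈ colCells μ j, F (t.cell (β (t.entry c))) = ∑ c ∈ colCells μ j, F c := by
  have key : ∀ β ∈ t.colStabilizer, ∀ c ∈ colCells μ j,
      t.cell (β (t.entry c)) ∈ colCells μ j := by
    intro β hβ c hc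
    have h := hβ (t.entry c)
    simp only [colCells, Finset.mem_filter, Finset.mem_univ, true_and, Tableau.colOf,
      Tableau.cell_entry] at hc h ⊢
    exact h.trans hc
  refine Finset.sum_bij' (fun c _ => t.cell (β (t.entry c))) (fun c _ => t.cell (β⁻¹ (t.entry c)))
    (key β hβ) (key β⁻¹ (inv_mem hβ)) ?_ ?_ ?_ <;> simp

theorem colTabloid_exchange_smul (t : Tableau μ N) {β : Perm (Fin N)} (hβ : β ∈ t.colStabilizer)
    (c d : μ.cells) :
    colTabloid (exchange (β • t) c d) = ((Perm.sign β : ℤ) : ℂ) •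
      colTabloid (exchange t (t.cell (β (t.entry c))) (t.cell (β (t.entry d)))) := by
  set s := swap (β (t.entry c)) (β (t.entry d)) with hs
  have h1 : exchange (β • t) c d = (s * β * s⁻¹) • (s • t) := by
    simp [exchange, smul_smul, hs]
  have h2 : exchange t (t.cell (β (t.entry c))) (t.cell (β (t.entry d))) = s • t := by
    simp [exchange, hs]
  have h3 : s * β * s⁻¹ ∈ (s • t).colStabilizer := by
    rw [Tableau.mem_colStabilizer_smul]
    simpa [mul_assoc] using hβ
  rw [h1, h2, colTabloid_smul_of_mem _ h3, sign_conj]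

theorem etaFun_smul_of_mem (t : Tableau μ N) (β : Perm (Fin N)) (hβ : β ∈ t.colStabilizer) :
    etaFun (β • t) = ((Perm.sign β : ℤ) : ℂ) • etaFun t := by
  simp only [etaFun, garnirOne, piOne, colTabloid_smul_of_mem t hβ,
    colTabloid_exchange_smul t hβ, ← Finset.smul_sum, ← smul_sub]
  congr 1
  rw [← sum_colCells_reindex t hβ 1
    (fun d => colTabloid t - ∑ c ∈ colCells μ 0, colTabloid (exchange t c d))]
  refine Finset.sum_congr rfl fun d _ => ?_
  rw [← sum_colCells_reindex t hβ 0
    (fun c => colTabloid (exchange t c (t.cell (β (t.entry d)))))]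

/-- The map `η : M̃^μ → M̃^μ`, which sends `[t]` to the sum, over the cells `d` of the second
column, of `[t]` minus the sum of all column tabloids obtained from `t` by exchanging the entry
in `d` with an entry of the first column. -/
def eta (μ : YoungDiagram) (N : ℕ) : (colRep μ N).IntertwiningMap (colRep μ N) where
  toLinearMap := colLift etaFun etaFun_smul_of_mem
  isIntertwining' σ := colSpace_hom_ext fun t => by
    simp only [LinearMap.comp_apply, colRep_colTabloid, colLift_colTabloid]
    simp [etaFun, garnirOne, piOne, exchange_smul]

theorem eta_colTabloid (t : Tableau μ N) : eta μ N (colTabloid t) =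
    ∑ d ∈ colCells μ 1, (colTabloid t - ∑ c ∈ colCells μ 0, colTabloid (exchange t c d)) :=
  colLift_colTabloid etaFun etaFun_smul_of_mem t

end TwoColumn

end

/-!
Let a permutation `π` of the cells act on tableaux from the right, `t ↦ t ∘ π`. Antisymmetrizing
embeds `M̃^μ` into the space of functions on tableaux (`altMap`, `altMap_injective`), and its image
consists of functions `f` that are alternating under column permutations of the cells. There

* `η` becomes the sum of the Garnir operators `G_d f = f - ∑_c f ∘ (c d)`, where `d` runs through the
  second column and `c` through the first one (`altMap_eta`);
* the coefficient of `α(f)` at a row tabloid `{s}` becomes the sum of `f (s ∘ ρ)` over the row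
  permutations `ρ` (`alpha_apply_rowTabloid`).

The function `G_d f` is, up to a scalar, the antisymmetrization of `f` over the first column and `d`,
so the transposition of `d` with the cell to its left changes the sign of `G_d f` (`garnir_swap`).
Hence the row sums of `G_d f` vanish, which means `α ∘ η = 0` (`alpha_eta`).

Moreover `ker η ∩ ker α = 0` (`eq_zero_of_eta_of_alpha`). If `η f = 0`, then `G_d f = 0` for each `d`,
because `‖G_d f‖² = (n + 1) ⟨f, G_d f⟩` and these numbers add up to zero. Let `F_k` be the sum of
the translates of `f` by the row permutations of the first `k` rows. If `F_{k+1} = 0`, then the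
transposition of the two cells of the row with index `k` changes the sign of `F_k`, and the sum of
the equation `G_d f = 0`, `d = (k, 1)`, over these row permutations becomes `(n - k + 1) F_k = 0`
(`rowSum_eq_zero_of_succ`). Starting from `F_m = 0`, which is `α(f) = 0`, one arrives at
`f = F_0 = 0`.

Since `im η ⊆ ker α` and `ker η ∩ ker α = 0`, comparing dimensions shows that `im η = ker α` and that
`M̃^μ = ker η ⊕ ker α`, so `α`, which is surjective, maps `ker η` isomorphically onto `S^μ`.
-/

noncomputable section

namespace TwoColumn

open Equiv

variable {μ : YoungDiagram} {N : ℕ}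

/-! ### Permutations of the cells -/

namespace Tableau

instance : DecidableEq (Tableau μ N) := inferInstanceAs (DecidableEq (μ.cells ≃ Fin N))

instance : Finite (Tableau μ N) := inferInstanceAs (Finite (μ.cells ≃ Fin N))

instance : Fintype (Tableau μ N) := Fintype.ofFinite _

/-- The right action of permutations of the cells on tableaux: the entry of `t.permCells π` in the
cell `c` is the entry of `t` in the cell `π c`. -/
def permCells (t : Tableau μ N) (π : Perm μ.cells) : Tableau μ N := Equiv.trans π t

theorem entry_permCells (t : Tableau μ N) (π : Perm μ.cells) (c : μ.cells) :
    (t.permCells π).entry c = t.entry (π c) := rfl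

theorem cell_permCells (t : Tableau μ N) (π : Perm μ.cells) (a : Fin N) :
    (t.permCells π).cell a = π⁻¹ (t.cell a) := rfl

@[simp] theorem permCells_one (t : Tableau μ N) : t.permCells 1 = t := rfl

theorem permCells_permCells (t : Tableau μ N) (π ρ : Perm μ.cells) :
    (t.permCells π).permCells ρ = t.permCells (π * ρ) := rfl

theorem ext_entry {s t : Tableau μ N} (h : ∀ c, s.entry c = t.entry c) : s = t :=
  Equiv.ext h

theorem entry_injective (t : Tableau μ N) : Function.Injective t.entry :=
  Equiv.injective t

theorem exists_permCells_eq (s t : Tableau μ N) : ∃ ρ, s.permCells ρ = t :=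
  ⟨Equiv.trans t (Equiv.symm s), ext_entry fun c => entry_cell s (t.entry c)⟩

theorem permCells_injective (t : Tableau μ N) : Function.Injective t.permCells := by
  intro π ρ h
  ext1 c
  exact t.entry_injective (congrArg (fun s => s.entry c) h)

/-- Translation by a permutation of the cells, as a bijection of the set of tableaux. -/
def permCellsEquiv (π : Perm μ.cells) : Tableau μ N ≃ Tableau μ N where
  toFun t := t.permCells π
  invFun t := t.permCells π⁻¹
  left_inv t := by simp [permCells_permCells]
  right_inv t := by simp [permCells_permCells]

/-- A permutation of the cells acts on `t` like its conjugate by `t`, a permutation of the letters. -/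
theorem permCells_eq_smul (t : Tableau μ N) (π : Perm μ.cells) :
    t.permCells π = (Equiv.permCongr t π : Perm (Fin N)) • t :=
  ext_entry fun c => congrArg (fun x => t.entry (π x)) (cell_entry t c).symm

end Tableau

theorem exchange_eq_permCells (t : Tableau μ N) (c d : μ.cells) :
    exchange t c d = t.permCells (swap c d) := by
  refine Tableau.ext_entry fun x => ?_
  rw [exchange, Tableau.entry_smul, Tableau.entry_permCells]
  exact (t.entry_injective.swap_apply c d x).symm ▸ rfl

/-- The group of permutations of the cells that preserve each column. -/
def colGroup (μ : YoungDiagram) : Subgroup (Perm μ.cells) where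
  carrier := {π | ∀ c, (π c).1.2 = c.1.2}
  one_mem' _ := rfl
  mul_mem' {β γ} hβ hγ a := (hβ (γ a)).trans (hγ a)
  inv_mem' {β} hβ a := by simpa using (hβ (β⁻¹ a)).symm

theorem swap_mem_colGroup {c d : μ.cells} (h : c.1.2 = d.1.2) : swap c d ∈ colGroup μ := by
  intro x
  rw [swap_apply_def]
  split_ifs with h1 h2
  · rw [h1, h]
  · rw [h2, h]
  · rfl

instance : DecidablePred (· ∈ colGroup μ) := fun π =>
  inferInstanceAs (Decidable (∀ c, (π c).1.2 = c.1.2))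

/-- The column stabilizer of `t`, transported to the cells. -/
def colStabilizerEquiv (t : Tableau μ N) : colGroup μ ≃ t.colStabilizer :=
  (Equiv.permCongr t).subtypeEquiv fun π => by
    refine ⟨fun h a => ?_, fun h c => ?_⟩
    · have := h (t.cell a)
      change (t.cell (t.entry (π (t.cell a)))).1.2 = _
      rwa [Tableau.cell_entry]
    · have : (t.cell (t.entry (π (t.cell (t.entry c))))).1.2 = (t.cell (t.entry c)).1.2 :=
        h (t.entry c)
      rwa [Tableau.cell_entry, Tableau.cell_entry] at this

theorem colStabilizerEquiv_smul (t : Tableau μ N) (π : colGroup μ) :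
    (colStabilizerEquiv t π).1 • t = t.permCells π.1 :=
  (t.permCells_eq_smul π.1).symm

theorem sign_colStabilizerEquiv (t : Tableau μ N) (π : colGroup μ) :
    Perm.sign (colStabilizerEquiv t π).1 = Perm.sign π.1 :=
  Perm.sign_permCongr t π.1

/-! ### Column tabloids as alternating functions on tableaux -/

/-- The functions on tableaux that are antisymmetric within columns. -/
def IsAlternating (f : Tableau μ N → ℂ) : Prop :=
  ∀ π ∈ colGroup μ, ∀ t, f (t.permCells π) = ((Perm.sign π : ℤ) : ℂ) * f t

theorem IsAlternating.swap {f : Tableau μ N → ℂ} (hf : IsAlternating f) {c d : μ.cells}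
    (h : c.1.2 = d.1.2) (hcd : c ≠ d) (t : Tableau μ N) :
    f (t.permCells (swap c d)) = -f t := by
  rw [hf _ (swap_mem_colGroup h), Perm.sign_swap hcd]
  simp

/-- The alternating sum of the (indicator functions of the) tableaux in the column class of `t`. -/
def altFun (t s : Tableau μ N) : ℂ :=
  ∑ π : colGroup μ, ((Perm.sign π.1 : ℤ) : ℂ) * if t.permCells π.1 = s then 1 else 0

theorem sign_mul_sign {X : Type*} [Fintype X] [DecidableEq X] (π ρ : Perm X) :
    ((Perm.sign (π * ρ) : ℤ) : ℂ) = ((Perm.sign π : ℤ) : ℂ) * ((Perm.sign ρ : ℤ) : ℂ) := by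
  simp

theorem sign_sq {X : Type*} [Fintype X] [DecidableEq X] (π : Perm X) :
    ((Perm.sign π : ℤ) : ℂ) * ((Perm.sign π : ℤ) : ℂ) = 1 := by
  rcases Int.units_eq_one_or (Perm.sign π) with h | h <;> simp [h]

theorem altFun_permCells_left (t s : Tableau μ N) (β : colGroup μ) :
    altFun (t.permCells β.1) s = ((Perm.sign β.1 : ℤ) : ℂ) * altFun t s := by
  rw [altFun, altFun, Finset.mul_sum]
  refine Fintype.sum_equiv (Equiv.mulLeft β) _ _ fun π => ?_
  simp only [Equiv.coe_mulLeft, Subgroup.coe_mul, sign_mul_sign, Tableau.permCells_permCells]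
  rw [← mul_assoc, ← mul_assoc, sign_sq, one_mul]
  congr

theorem isAlternating_altFun (t : Tableau μ N) : IsAlternating (altFun t) := by
  intro β hβ s
  rw [altFun, altFun, Finset.mul_sum]
  refine Fintype.sum_equiv (Equiv.mulRight (⟨β, hβ⟩ : colGroup μ)⁻¹) _ _ fun π => ?_
  have h : t.permCells π.1 = s.permCells β ↔ t.permCells (π.1 * β⁻¹) = s := by
    rw [← Tableau.permCells_permCells]
    exact (Tableau.permCellsEquiv β).symm_apply_eq.symm
  simp only [Equiv.coe_mulRight, Subgroup.coe_mul, Subgroup.coe_inv, sign_mul_sign, h,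
    Perm.sign_inv]
  rw [← mul_assoc, mul_left_comm, sign_sq, mul_one]
  congr

/-- The embedding of `M̃^μ` into the space of functions on tableaux, `[t] ↦ ∑_π sgn(π) (t ∘ π)`. -/
def altMap (μ : YoungDiagram) (N : ℕ) : ColSpace μ N →ₗ[ℂ] (Tableau μ N → ℂ) :=
  colLift altFun fun t β hβ => by
    obtain ⟨π, hπ⟩ := (colStabilizerEquiv t).surjective ⟨β, hβ⟩
    have h1 := colStabilizerEquiv_smul t π
    have h2 := sign_colStabilizerEquiv t π
    rw [hπ] at h1 h2
    ext s
    simp only at h1 h2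
    rw [h1, altFun_permCells_left, h2]
    rfl

@[simp] theorem altMap_colTabloid (t : Tableau μ N) : altMap μ N (colTabloid t) = altFun t :=
  colLift_colTabloid _ _ t

theorem colSpace_induction {p : ColSpace μ N → Prop} (y : ColSpace μ N)
    (tab : ∀ t, p (colTabloid t)) (zero : p 0) (add : ∀ x y, p x → p y → p (x + y))
    (smul : ∀ (a : ℂ) x, p x → p (a • x)) : p y := by
  obtain ⟨y, rfl⟩ := (antisymm μ N).mkQ_surjective y
  induction y using Finsupp.induction_linear with
  | zero => simpa using zero
  | add x y hx hy => rw [map_add]; exact add _ _ hx hy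
  | single t a =>
    have : (Finsupp.single t a : Tableau μ N →₀ ℂ) = a • Finsupp.single t 1 := by simp
    rw [this, map_smul]
    exact smul _ _ (tab t)

theorem isAlternating_altMap (y : ColSpace μ N) : IsAlternating (altMap μ N y) := by
  induction y using colSpace_induction with
  | tab t => rw [altMap_colTabloid]; exact isAlternating_altFun t
  | zero => intro π _ t; simp
  | add x y hx hy =>
    intro π hπ t
    simp only [map_add, Pi.add_apply, hx π hπ, hy π hπ, mul_add]
  | smul a x hx =>
    intro π hπ t
    simp only [map_smul, Pi.smul_apply, smul_eq_mul, hx π hπ, mul_left_comm]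

/-- Mapping a function `f` on tableaux to `∑ f(s) [s]` inverts `altMap` up to the factor
`|colGroup μ|`. -/
theorem sum_altMap_smul_colTabloid (y : ColSpace μ N) :
    ∑ s, altMap μ N y s • colTabloid s = (Fintype.card (colGroup μ) : ℂ) • y := by
  induction y using colSpace_induction with
  | tab t =>
    simp only [altMap_colTabloid, altFun, Finset.sum_smul]
    rw [Finset.sum_comm]
    simp only [mul_ite, mul_one, mul_zero, ite_smul, zero_smul, Finset.sum_ite_eq, Finset.mem_univ,
      if_true]
    have h : ∀ π : colGroup μ,
        ((Perm.sign π.1 : ℤ) : ℂ) • colTabloid (t.permCells π.1) = colTabloid t := by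
      intro π
      rw [← colStabilizerEquiv_smul, colTabloid_smul_of_mem _ (colStabilizerEquiv t π).2,
        sign_colStabilizerEquiv, smul_smul, sign_sq, one_smul]
    simp only [h, Finset.sum_const, Finset.card_univ, Nat.cast_smul_eq_nsmul]
  | zero => simp
  | add x y hx hy => simp only [map_add, Pi.add_apply, add_smul, Finset.sum_add_distrib, hx, hy,
      smul_add]
  | smul a x hx =>
    simp only [map_smul, Pi.smul_apply, smul_eq_mul, mul_smul, ← Finset.smul_sum, hx]
    rw [smul_comm]

theorem altMap_injective : Function.Injective (altMap μ N) := by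
  rw [injective_iff_map_eq_zero]
  intro y hy
  have h := sum_altMap_smul_colTabloid y
  simp only [hy, Pi.zero_apply, zero_smul, Finset.sum_const_zero] at h
  exact (smul_eq_zero.1 h.symm).resolve_left (Nat.cast_ne_zero.2 Fintype.card_ne_zero)

/-! ### The Garnir operators -/

/-- The Garnir operator of a cell `d` of the second column, on functions on tableaux: `f` minus the
sum of its translates by the transpositions of `d` with the cells of the first column. -/
def garnir (d : μ.cells) (f : Tableau μ N → ℂ) (t : Tableau μ N) : ℂ :=
  f t - ∑ c ∈ colCells μ 0, f (t.permCells (swap c d))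

theorem mem_colCells {j : ℕ} {c : μ.cells} : c ∈ colCells μ j ↔ c.1.2 = j := by
  simp [colCells]

theorem sum_colCells_perm {V : Type*} [AddCommMonoid V] {π : Perm μ.cells} (hπ : π ∈ colGroup μ)
    (j : ℕ) (F : μ.cells → V) :
    ∑ c ∈ colCells μ j, F (π c) = ∑ c ∈ colCells μ j, F c :=
  Finset.sum_equiv π (fun c => by rw [mem_colCells, mem_colCells, hπ c]) fun _ _ => rfl

theorem altFun_permCells_right (t s : Tableau μ N) (c d : μ.cells) :
    altFun t (s.permCells (swap c d)) = ∑ π : colGroup μ, ((Perm.sign π.1 : ℤ) : ℂ) *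
      if t.permCells (π.1 * swap c d) = s then 1 else 0 := by
  refine Finset.sum_congr rfl fun π _ => ?_
  have h : t.permCells π.1 = s.permCells (swap c d) ↔ t.permCells (π.1 * swap c d) = s := by
    rw [← Tableau.permCells_permCells]
    simpa [Tableau.permCellsEquiv] using
      (Tableau.permCellsEquiv (swap c d)).symm_apply_eq (x := t.permCells π.1) (y := s) |>.symm
  simp only [h]

theorem sum_altFun_swap (t s : Tableau μ N) :
    ∑ d ∈ colCells μ 1, ∑ c ∈ colCells μ 0, altFun (t.permCells (swap c d)) s =
      ∑ d ∈ colCells μ 1, ∑ c ∈ colCells μ 0, altFun t (s.permCells (swap c d)) := by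
  have hl : ∀ c d : μ.cells, altFun (t.permCells (swap c d)) s = ∑ π : colGroup μ,
      ((Perm.sign π.1 : ℤ) : ℂ) * if t.permCells (swap c d * π.1) = s then 1 else 0 :=
    fun _ _ => rfl
  simp_rw [hl, altFun_permCells_right]
  rw [Finset.sum_congr rfl fun d _ => Finset.sum_comm, Finset.sum_comm]
  conv_rhs => rw [Finset.sum_congr rfl fun d _ => Finset.sum_comm, Finset.sum_comm]
  refine Finset.sum_congr rfl fun π _ => ?_
  -- Conjugation by `π` permutes the transpositions `swap c d`.
  rw [← sum_colCells_perm π.2 1]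
  refine Finset.sum_congr rfl fun d _ => ?_
  rw [← sum_colCells_perm π.2 0]
  refine Finset.sum_congr rfl fun c _ => ?_
  rw [mul_swap_eq_swap_mul π.1 c d]

/-- Under `altMap`, the map `η` becomes the sum of the Garnir operators. -/
theorem altMap_eta (y : ColSpace μ N) (s : Tableau μ N) :
    altMap μ N (eta μ N y) s = ∑ d ∈ colCells μ 1, garnir d (altMap μ N y) s := by
  induction y using colSpace_induction with
  | tab t =>
    simp only [eta_colTabloid, map_sum, map_sub, altMap_colTabloid, Finset.sum_apply, Pi.sub_apply,
      garnir, Finset.sum_sub_distrib, exchange_eq_permCells, sum_altFun_swap]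
  | zero => simp [garnir]
  | add x y hx hy =>
    simp only [map_add, Pi.add_apply, hx, hy, ← Finset.sum_add_distrib, garnir]
    refine Finset.sum_congr rfl fun d _ => ?_
    rw [Finset.sum_add_distrib]
    ring
  | smul a x hx =>
    simp only [map_smul, Pi.smul_apply, smul_eq_mul, hx, Finset.mul_sum, garnir, mul_sub]

/-- The function `garnir d f` is, up to a scalar, the antisymmetrization of `f` over the first
column together with the cell `d`; so it changes its sign under `swap c d`. -/
theorem garnir_swap {f : Tableau μ N → ℂ} (hf : IsAlternating f) {c d : μ.cells}
    (hc : c.1.2 = 0) (hd : d.1.2 = 1) (t : Tableau μ N) :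
    garnir d f (t.permCells (swap c d)) = -garnir d f t := by
  have hcm : c ∈ colCells μ 0 := mem_colCells.2 hc
  have hne : ∀ x : μ.cells, x.1.2 = 0 → x ≠ d := by
    rintro x hx rfl
    omega
  rw [garnir, garnir, ← Finset.add_sum_erase _ _ hcm,
    ← Finset.add_sum_erase _ (fun x => f (t.permCells (swap x d))) hcm]
  have h : ∀ x ∈ (colCells μ 0).erase c, f ((t.permCells (swap c d)).permCells (swap x d)) =
      -f (t.permCells (swap x d)) := by
    intro x hx
    obtain ⟨hxc, hx⟩ := Finset.mem_erase.1 hx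
    rw [mem_colCells] at hx
    have h1 : swap c d * swap x d = swap x d * swap c x := by
      rw [mul_swap_eq_swap_mul (swap x d) c x, swap_apply_left,
        swap_apply_of_ne_of_ne hxc.symm (hne c hc)]
    rw [Tableau.permCells_permCells, h1, ← Tableau.permCells_permCells,
      hf.swap (hc.trans hx.symm) hxc.symm]
  rw [Finset.sum_congr rfl h, Finset.sum_neg_distrib, Tableau.permCells_permCells, swap_mul_self,
    Tableau.permCells_one]
  ring

open ComplexConjugate in
/-- `‖garnir d f‖² = (n + 1) ⟨f, garnir d f⟩`, where `n` is the length of the first column. -/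
theorem sum_normSq_garnir {f : Tableau μ N → ℂ} (hf : IsAlternating f) {d : μ.cells}
    (hd : d.1.2 = 1) :
    ∑ t, conj (garnir d f t) * garnir d f t =
      ((colCells μ 0).card + 1) * ∑ t, conj (f t) * garnir d f t := by
  have h : ∀ c ∈ colCells μ 0, ∑ t, conj (f (t.permCells (swap c d))) * garnir d f t =
      -∑ t, conj (f t) * garnir d f t := by
    intro c hc
    rw [← Finset.sum_neg_distrib]
    refine Fintype.sum_equiv (Tableau.permCellsEquiv (swap c d)) _ _ fun t => ?_
    change _ = -(conj (f (t.permCells (swap c d))) * garnir d f (t.permCells (swap c d)))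
    rw [garnir_swap hf (mem_colCells.1 hc) hd]
    ring
  have h2 : ∀ t, conj (garnir d f t) * garnir d f t = conj (f t) * garnir d f t -
      ∑ c ∈ colCells μ 0, conj (f (t.permCells (swap c d))) * garnir d f t := by
    intro t
    rw [← Finset.sum_mul, ← sub_mul, ← map_sum, ← map_sub]
    rfl
  simp only [h2, Finset.sum_sub_distrib]
  rw [Finset.sum_comm, Finset.sum_congr rfl h, Finset.sum_const, nsmul_eq_mul]
  ring

open ComplexConjugate in
/-- The Garnir operators of the cells of the second column are positive semidefinite, so their sum
vanishes only where each of them does. -/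
theorem garnir_eq_zero_of_sum_eq_zero {f : Tableau μ N → ℂ} (hf : IsAlternating f)
    (h : ∀ t, ∑ d ∈ colCells μ 1, garnir d f t = 0) {d : μ.cells} (hd : d.1.2 = 1)
    (t : Tableau μ N) : garnir d f t = 0 := by
  have h1 : ∑ d ∈ colCells μ 1, ∑ t, conj (garnir d f t) * garnir d f t = 0 := by
    rw [Finset.sum_congr rfl fun d hd => sum_normSq_garnir hf (mem_colCells.1 hd),
      ← Finset.mul_sum, Finset.sum_comm]
    simp only [← Finset.mul_sum, h, mul_zero, Finset.sum_const_zero]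
  have h2 : ∑ d ∈ colCells μ 1, ∑ t, Complex.normSq (garnir d f t) = 0 := by
    simp only [← Complex.normSq_eq_conj_mul_self] at h1
    exact_mod_cast h1
  have h3 := (Finset.sum_eq_zero_iff_of_nonneg fun d _ =>
    Finset.sum_nonneg fun t _ => Complex.normSq_nonneg (garnir d f t)).1 h2 d (mem_colCells.2 hd)
  exact Complex.normSq_eq_zero.1
    ((Finset.sum_eq_zero_iff_of_nonneg fun t _ => Complex.normSq_nonneg _).1 h3 t
      (Finset.mem_univ t))

/-! ### Sums over row groups -/

/-- The group of the permutations of the cells that preserve each row and move only cells in the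
first `k` rows. -/
def rowGroup (μ : YoungDiagram) (k : ℕ) : Subgroup (Perm μ.cells) where
  carrier := {ρ | ∀ c, (ρ c).1.1 = c.1.1 ∧ (k ≤ c.1.1 → ρ c = c)}
  one_mem' _ := ⟨rfl, fun _ => rfl⟩
  mul_mem' {β γ} hβ hγ c := by
    refine ⟨(hβ (γ c)).1.trans (hγ c).1, fun h => ?_⟩
    rw [Perm.mul_apply, (hγ c).2 h, (hβ c).2 h]
  inv_mem' {β} hβ c := by
    refine ⟨by simpa using (hβ (β⁻¹ c)).1.symm, fun h => ?_⟩
    rw [Perm.inv_eq_iff_eq, (hβ c).2 h]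

instance (k : ℕ) : DecidablePred (· ∈ rowGroup μ k) := fun ρ =>
  inferInstanceAs (Decidable (∀ c, (ρ c).1.1 = c.1.1 ∧ (k ≤ c.1.1 → ρ c = c)))

theorem swap_mem_rowGroup {k : ℕ} {c d : μ.cells} (h : c.1.1 = d.1.1) (hk : c.1.1 < k) :
    swap c d ∈ rowGroup μ k := by
  intro x
  rw [swap_apply_def]
  split_ifs with h1 h2
  · subst h1
    exact ⟨h.symm, fun h => absurd hk (by omega)⟩
  · subst h2
    exact ⟨h, fun h => absurd hk (by omega)⟩
  · exact ⟨rfl, fun _ => rfl⟩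

theorem swap_mul_comm_of_mem_rowGroup {k : ℕ} {c d : μ.cells} (hc : k ≤ c.1.1) (hd : k ≤ d.1.1)
    {ρ : Perm μ.cells} (hρ : ρ ∈ rowGroup μ k) : ρ * swap c d = swap c d * ρ := by
  rw [mul_swap_eq_swap_mul, (hρ c).2 hc, (hρ d).2 hd]

/-- The sum of the translates of `f` by the elements of `rowGroup μ k`. -/
def rowSum (k : ℕ) (f : Tableau μ N → ℂ) (t : Tableau μ N) : ℂ :=
  ∑ ρ with ρ ∈ rowGroup μ k, f (t.permCells ρ)

theorem rowSum_zero (f : Tableau μ N → ℂ) (t : Tableau μ N) : rowSum 0 f t = f t := by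
  have h : (Finset.univ.filter (· ∈ rowGroup μ 0)) = {1} := by
    ext ρ
    simp only [Finset.mem_filter, Finset.mem_univ, true_and, Finset.mem_singleton]
    refine ⟨fun h => Equiv.ext fun c => (h c).2 (Nat.zero_le _), ?_⟩
    rintro rfl
    exact one_mem _
  rw [rowSum, h, Finset.sum_singleton, Tableau.permCells_one]

/-- If `τ` lies in the row group and `f (s ∘ τ π) = -f (s ∘ π)` for all `s`, then the terms of `ρ` and
`ρ τ` in the sum of `f (t ∘ ρ π)` over the row group cancel. -/
theorem sum_rowGroup_eq_zero {k : ℕ} {f : Tableau μ N → ℂ} {t : Tableau μ N} {τ : Perm μ.cells}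
    (hτ : τ ∈ rowGroup μ k) (π : Perm μ.cells)
    (h : ∀ s : Tableau μ N, f (s.permCells (τ * π)) = -f (s.permCells π)) :
    ∑ ρ with ρ ∈ rowGroup μ k, f (t.permCells (ρ * π)) = 0 := by
  have h1 : ∑ ρ with ρ ∈ rowGroup μ k, f (t.permCells (ρ * π)) =
      ∑ ρ with ρ ∈ rowGroup μ k, -f (t.permCells (ρ * π)) := by
    refine Finset.sum_equiv (Equiv.mulRight τ⁻¹) (fun ρ => ?_) fun ρ _ => ?_
    · simp [Subgroup.mul_mem_cancel_right _ (inv_mem hτ)]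
    · have := h (t.permCells (ρ * τ⁻¹))
      rw [Tableau.permCells_permCells, Tableau.permCells_permCells] at this
      rw [Equiv.coe_mulRight, ← this, mul_assoc, inv_mul_cancel_left]
  rw [Finset.sum_neg_distrib] at h1
  exact self_eq_neg.1 h1

theorem rowSum_swap {k : ℕ} {f : Tableau μ N → ℂ} (hf : IsAlternating f) {c d : μ.cells}
    (h : c.1.2 = d.1.2) (hcd : c ≠ d) (hc : k ≤ c.1.1) (hd : k ≤ d.1.1) (t : Tableau μ N) :
    rowSum k f (t.permCells (swap c d)) = -rowSum k f t := by
  rw [rowSum, rowSum, ← Finset.sum_neg_distrib]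
  refine Finset.sum_congr rfl fun ρ hρ => ?_
  rw [Tableau.permCells_permCells,
    ← swap_mul_comm_of_mem_rowGroup hc hd (Finset.mem_filter.1 hρ).2,
    ← Tableau.permCells_permCells, hf.swap h hcd]

section Shape

variable {n m : ℕ} {hmn : m ≤ n}

theorem shape_cell (x : (shape n m hmn).cells) :
    x.1.1 < n ∧ x.1.2 = 0 ∨ x.1.1 < m ∧ x.1.2 = 1 := by
  have h : x.1 ∈ (Finset.range n ×ˢ {0}) ∪ (Finset.range m ×ˢ {1}) := x.2
  simpa only [Finset.mem_union, Finset.mem_product, Finset.mem_range, Finset.mem_singleton] using h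

theorem shape_exists_left {i : ℕ} (hi : i < n) :
    ∃ c : (shape n m hmn).cells, c.1.1 = i ∧ c.1.2 = 0 :=
  ⟨⟨(i, 0), by simp [shape, hi]⟩, rfl, rfl⟩

theorem shape_exists_right {i : ℕ} (hi : i < m) :
    ∃ d : (shape n m hmn).cells, d.1.1 = i ∧ d.1.2 = 1 :=
  ⟨⟨(i, 1), by simp [shape, hi]⟩, rfl, rfl⟩

theorem cell_ext {x y : μ.cells} (h1 : x.1.1 = y.1.1) (h2 : x.1.2 = y.1.2) : x = y :=
  Subtype.ext (Prod.ext h1 h2)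

/-- `rowGroup (k + 1)` is the union of `rowGroup k` and its coset by the transposition of the two
cells of the row with index `k`. -/
theorem rowSum_succ {k : ℕ} {c d : (shape n m hmn).cells} (hc1 : c.1.1 = k) (hc2 : c.1.2 = 0)
    (hd1 : d.1.1 = k) (hd2 : d.1.2 = 1) (f : Tableau (shape n m hmn) N → ℂ)
    (t : Tableau (shape n m hmn) N) :
    rowSum (k + 1) f t = rowSum k f t + rowSum k f (t.permCells (swap c d)) := by
  have hcd : c ≠ d := by
    rintro rfl
    omega
  have hrow : ∀ x : (shape n m hmn).cells, x.1.1 = k → x = c ∨ x = d := by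
    intro x hx
    rcases shape_cell x with h | h
    · exact .inl (cell_ext (by omega) (by omega))
    · exact .inr (cell_ext (by omega) (by omega))
  have hmono : ∀ ρ ∈ rowGroup (shape n m hmn) k, ρ ∈ rowGroup (shape n m hmn) (k + 1) :=
    fun ρ hρ x => ⟨(hρ x).1, fun h => (hρ x).2 (by omega)⟩
  have hsw : swap c d ∈ rowGroup (shape n m hmn) (k + 1) :=
    swap_mem_rowGroup (by omega) (by omega)
  have hfix : ∀ ρ ∈ rowGroup (shape n m hmn) (k + 1), ρ c = c → ρ ∈ rowGroup _ k := by
    intro ρ hρ hρc x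
    refine ⟨(hρ x).1, fun h => ?_⟩
    rcases Nat.eq_or_lt_of_le h with h | h
    · rcases hrow x h.symm with rfl | rfl
      · exact hρc
      · refine (hrow (ρ x) ((hρ x).1.trans hd1)).resolve_left fun h => hcd ?_
        exact ρ.injective (hρc.trans h.symm)
    · exact (hρ x).2 h
  rw [rowSum, ← Finset.sum_filter_add_sum_filter_not _ (fun ρ => ρ c = c)]
  congr 1
  · refine Finset.sum_congr (Finset.ext fun ρ => ?_) fun _ _ => rfl
    simp only [Finset.mem_filter, Finset.mem_univ, true_and]
    exact ⟨fun h => hfix ρ h.1 h.2, fun h => ⟨hmono ρ h, (h c).2 hc1.ge⟩⟩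
  · refine Finset.sum_equiv (Equiv.mulLeft (swap c d)) (fun ρ => ?_) fun ρ _ => ?_
    · simp only [Finset.mem_filter, Finset.mem_univ, true_and, Equiv.coe_mulLeft]
      constructor
      · rintro ⟨h, hρc⟩
        refine hfix _ (mul_mem hsw h) ?_
        rw [Perm.mul_apply, (hrow (ρ c) ((h c).1.trans hc1)).resolve_left hρc, swap_apply_right]
      · intro h
        refine ⟨by simpa using mul_mem hsw (hmono _ h), fun hρc => hcd ?_⟩
        have := (h c).2 hc1.ge
        rw [Perm.mul_apply, hρc, swap_apply_left] at this
        exact this.symm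
    · rw [Equiv.coe_mulLeft, Tableau.permCells_permCells, swap_mul_self_mul]

/-- The images of the Garnir operators have vanishing row sums. -/
theorem rowSum_garnir {f : Tableau (shape n m hmn) N → ℂ} (hf : IsAlternating f)
    {d : (shape n m hmn).cells} (hd : d.1.2 = 1) (t : Tableau (shape n m hmn) N) :
    rowSum m (garnir d f) t = 0 := by
  have hdm : d.1.1 < m := by
    rcases shape_cell d with h | h <;> omega
  obtain ⟨c, hc1, hc2⟩ := shape_exists_left (hmn := hmn) (hdm.trans_le hmn)
  have := sum_rowGroup_eq_zero (t := t) (f := garnir d f)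
    (swap_mem_rowGroup (k := m) hc1 (hc1.trans_lt hdm)) 1
    (fun s => by rw [mul_one, Tableau.permCells_one, garnir_swap hf hc2 hd])
  simpa [rowSum] using this

/-- Descent along the rows: for an `f` that is annihilated by the Garnir operators, the row
sums over `rowGroup k` vanish if those over `rowGroup (k + 1)` do. The equation that is used is the
one of the cell `(k, 1)`. -/
theorem rowSum_eq_zero_of_succ {f : Tableau (shape n m hmn) N → ℂ} (hf : IsAlternating f)
    {k : ℕ} (hk : k < m) (hg : ∀ d : (shape n m hmn).cells, d.1.2 = 1 → ∀ t, garnir d f t = 0)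
    (h : ∀ t, rowSum (k + 1) f t = 0) (t : Tableau (shape n m hmn) N) : rowSum k f t = 0 := by
  obtain ⟨a, ha1, ha2⟩ := shape_exists_left (hmn := hmn) (hk.trans_le hmn)
  obtain ⟨b, hb1, hb2⟩ := shape_exists_right (hmn := hmn) hk
  have hab : ∀ t, rowSum k f (t.permCells (swap a b)) = -rowSum k f t := fun t =>
    (neg_eq_of_add_eq_zero_right ((rowSum_succ ha1 ha2 hb1 hb2 f t).symm.trans (h t))).symm
  -- Exchanging `b` with a cell `c` of the first column annihilates the row sum if `c` lies above
  -- `b`, and changes its sign otherwise.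
  have key : ∀ c ∈ colCells (shape n m hmn) 0,
      ∑ ρ with ρ ∈ rowGroup (shape n m hmn) k, f (t.permCells (ρ * swap c b)) =
        if k ≤ c.1.1 then -rowSum k f t else 0 := by
    intro c hc
    rw [mem_colCells] at hc
    have hcb : c ≠ b := by
      rintro rfl
      omega
    split_ifs with hck
    · have h1 : ∑ ρ with ρ ∈ rowGroup (shape n m hmn) k, f (t.permCells (ρ * swap c b)) =
          rowSum k f (t.permCells (swap c b)) :=
        Finset.sum_congr rfl fun ρ hρ => by
          rw [Tableau.permCells_permCells,
            swap_mul_comm_of_mem_rowGroup hck hb1.ge (Finset.mem_filter.1 hρ).2]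
      rw [h1]
      by_cases hca : c = a
      · rw [hca, hab]
      · have hba : b ≠ a := by
          rintro rfl
          omega
        have h2 : swap c b = swap c a * (swap a b * swap c a) := by
          rw [← mul_assoc, swap_comm c a, swap_comm a b,
            swap_mul_swap_mul_swap hba hcb.symm]
        have hsw := rowSum_swap (k := k) hf (hc.trans ha2.symm) hca hck ha1.ge
        rw [h2, ← Tableau.permCells_permCells, ← Tableau.permCells_permCells, hsw, hab, hsw,
          neg_neg]
    · rw [not_le] at hck
      obtain ⟨e, he1, he2⟩ := shape_exists_right (hmn := hmn) (hck.trans hk)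
      have hce : c ≠ e := by
        rintro rfl
        omega
      have hbe : b ≠ e := by
        rintro rfl
        omega
      refine sum_rowGroup_eq_zero (swap_mem_rowGroup he1.symm hck) _ fun s => ?_
      have h2 : swap c e * swap c b = swap c b * swap b e := by
        rw [mul_swap_eq_swap_mul (swap c b), swap_apply_right,
          swap_apply_of_ne_of_ne hce.symm hbe.symm]
      rw [h2, ← Tableau.permCells_permCells, hf.swap (hb2.trans he2.symm) hbe]
  have h0 : ∑ ρ with ρ ∈ rowGroup (shape n m hmn) k, garnir b f (t.permCells ρ) = 0 :=
    Finset.sum_eq_zero fun ρ _ => hg b hb2 _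
  simp only [garnir, Finset.sum_sub_distrib, Tableau.permCells_permCells] at h0
  rw [Finset.sum_comm, Finset.sum_congr rfl key, ← Finset.sum_filter, Finset.sum_const,
    nsmul_eq_mul, ← rowSum, mul_neg, sub_neg_eq_add, ← one_add_mul] at h0
  refine (mul_eq_zero.1 h0).resolve_left ?_
  rw [add_comm]
  exact Nat.cast_add_one_ne_zero _

theorem eq_zero_of_garnir_of_rowSum {f : Tableau (shape n m hmn) N → ℂ} (hf : IsAlternating f)
    (hg : ∀ d : (shape n m hmn).cells, d.1.2 = 1 → ∀ t, garnir d f t = 0)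
    (h : ∀ t, rowSum m f t = 0) : f = 0 := by
  have key : ∀ k ≤ m, ∀ t, rowSum k f t = 0 := fun k hk =>
    Nat.decreasingInduction' (fun k hk _ ih => rowSum_eq_zero_of_succ hf hk hg ih) hk h
  ext t
  rw [← rowSum_zero f t, key 0 (Nat.zero_le m) t, Pi.zero_apply]

/-! ### The map `α` in terms of row sums -/

/-- The coefficients of `α(y)` are the sums of the alternating function of `y` over the row
equivalence classes. -/
theorem alpha_apply_rowTabloid (y : ColSpace (shape n m hmn) N) (s : Tableau (shape n m hmn) N) :
    ((alpha (shape n m hmn) N y : (specht (shape n m hmn) N).toSubmodule) :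
      RowTabloid (shape n m hmn) N →₀ ℂ) (rowTabloid s) = rowSum m (altMap _ N y) s := by
  classical
  induction y using colSpace_induction with
  | tab t =>
    rw [alpha_colTabloid, polytabloid, altMap_colTabloid, rowSum, Finsupp.finsetSum_apply]
    simp only [altFun]
    rw [Finset.sum_comm]
    refine (Fintype.sum_equiv (colStabilizerEquiv t) _ _ fun π => ?_).symm
    rw [sign_colStabilizerEquiv, colStabilizerEquiv_smul, ← Finset.mul_sum, Finsupp.smul_apply,
      smul_eq_mul, Finsupp.single_apply]
    congr 1
    obtain ⟨ρ, hρ⟩ := s.exists_permCells_eq (t.permCells π.1)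
    simp only [← hρ, s.permCells_injective.eq_iff, Finset.sum_ite_eq, Finset.mem_filter,
      Finset.mem_univ, true_and]
    refine if_congr ?_ rfl rfl
    have hrow : rowTabloid (s.permCells ρ) = rowTabloid s ↔
        ∀ a, (s.permCells ρ).rowOf a = s.rowOf a := Quotient.eq
    rw [hrow]
    constructor
    · intro h a
      have h1 := (h (ρ⁻¹ (s.cell a))).1
      have h2 : ρ (ρ⁻¹ (s.cell a)) = s.cell a := ρ.apply_symm_apply _
      rw [h2] at h1
      exact h1.symm
    · intro h c
      have h1 : (ρ c).1.1 = c.1.1 := by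
        have := h (s.entry (ρ c))
        simpa [Tableau.rowOf, Tableau.cell_permCells] using this.symm
      refine ⟨h1, fun hc => cell_ext h1 ?_⟩
      rcases shape_cell c with h2 | h2 <;> rcases shape_cell (ρ c) with h3 | h3 <;> omega
  | zero => simp [rowSum]
  | add x y hx hy =>
    simp only [map_add, Submodule.coe_add, Finsupp.add_apply, hx, hy, rowSum, Pi.add_apply,
      Finset.sum_add_distrib]
  | smul a x hx =>
    simp only [map_smul, Submodule.coe_smul, Finsupp.smul_apply, hx, rowSum, Pi.smul_apply,
      smul_eq_mul, Finset.mul_sum]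

theorem alpha_eq_zero_iff (y : ColSpace (shape n m hmn) N) :
    alpha (shape n m hmn) N y = 0 ↔ ∀ s, rowSum m (altMap _ N y) s = 0 := by
  simp only [← alpha_apply_rowTabloid]
  refine ⟨fun h s => by rw [h]; rfl, fun h => Subtype.ext (Finsupp.ext fun x => ?_)⟩
  induction x using Quotient.inductionOn with
  | h s => exact h s

theorem alpha_eta (y : ColSpace (shape n m hmn) N) :
    alpha (shape n m hmn) N (eta (shape n m hmn) N y) = 0 := by
  refine (alpha_eq_zero_iff _).2 fun s => ?_
  simp only [rowSum, altMap_eta]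
  rw [Finset.sum_comm]
  exact Finset.sum_eq_zero fun d hd =>
    rowSum_garnir (isAlternating_altMap y) (mem_colCells.1 hd) s

theorem eq_zero_of_eta_of_alpha {y : ColSpace (shape n m hmn) N}
    (h1 : eta (shape n m hmn) N y = 0) (h2 : alpha (shape n m hmn) N y = 0) : y = 0 := by
  have hy := isAlternating_altMap y
  refine altMap_injective ?_
  rw [map_zero]
  refine eq_zero_of_garnir_of_rowSum hy (fun d hd => ?_) ((alpha_eq_zero_iff y).1 h2)
  refine garnir_eq_zero_of_sum_eq_zero hy (fun t => ?_) hd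
  rw [← altMap_eta, h1, map_zero, Pi.zero_apply]

theorem alpha_surjective : Function.Surjective (alpha μ N) := by
  rintro ⟨x, hx⟩
  have h : Submodule.span ℂ (Set.range polytabloid) ≤
      (LinearMap.range (alpha μ N).toLinearMap).map (specht μ N).toSubmodule.subtype := by
    rw [Submodule.span_le]
    rintro _ ⟨t, rfl⟩
    exact ⟨_, ⟨colTabloid t, rfl⟩, alpha_colTabloid t⟩
  obtain ⟨_, ⟨y, rfl⟩, hy⟩ := h hx
  exact ⟨y, Subtype.ext hy⟩

end Shape

end TwoColumn

end

theorem theorem2p3 (n m : ℕ) (hm : 1 ≤ m) (hmn : m ≤ n) :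
    Nonempty ((TwoColumn.eta (TwoColumn.shape n m hmn) (n + m)).ker.toRepresentation.Equiv
      (TwoColumn.specht (TwoColumn.shape n m hmn) (n + m)).toRepresentation) ∧
    (TwoColumn.eta (TwoColumn.shape n m hmn) (n + m)).range =
      (TwoColumn.alpha (TwoColumn.shape n m hmn) (n + m)).ker := by
  set η := TwoColumn.eta (TwoColumn.shape n m hmn) (n + m)
  set α := TwoColumn.alpha (TwoColumn.shape n m hmn) (n + m)
  have hle : LinearMap.range η.toLinearMap ≤ LinearMap.ker α.toLinearMap := by
    rintro _ ⟨y, rfl⟩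
    exact TwoColumn.alpha_eta y
  have hdisj : Disjoint (LinearMap.ker η.toLinearMap) (LinearMap.ker α.toLinearMap) :=
    Submodule.disjoint_def.2 fun y h1 h2 => TwoColumn.eq_zero_of_eta_of_alpha h1 h2
  have hrank := η.toLinearMap.finrank_range_add_finrank_ker
  have hsum := Submodule.finrank_add_finrank_le_of_disjoint hdisj
  have heq : LinearMap.range η.toLinearMap = LinearMap.ker α.toLinearMap :=
    Submodule.eq_of_le_of_finrank_le hle (by omega)
  rw [heq] at hrank
  refine ⟨⟨.mk (LinearEquiv.ofBijective (α.toLinearMap ∘ₗ (LinearMap.ker η.toLinearMap).subtype)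
    ⟨?_, ?_⟩) fun g => ?_⟩, Subrepresentation.ext heq⟩
  · refine (injective_iff_map_eq_zero _).2 fun x hx => Subtype.ext ?_
    exact Submodule.disjoint_def.1 hdisj x.1 x.2 hx
  · intro x
    obtain ⟨y, rfl⟩ := TwoColumn.alpha_surjective x
    have htop : LinearMap.ker η.toLinearMap ⊔ LinearMap.ker α.toLinearMap = ⊤ :=
      Submodule.eq_top_of_disjoint _ _ (by omega) hdisj
    obtain ⟨u, hu, v, hv, rfl⟩ := Submodule.mem_sup.1 (htop ▸ Submodule.mem_top (x := y))
    refine ⟨⟨u, hu⟩, ?_⟩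
    have hv' : α v = 0 := hv
    change α u = α (u + v)
    rw [map_add, hv', add_zero]
  · exact LinearMap.ext fun x => α.isIntertwining _ _ g x.1
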